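/- Let $n\ge 1$ and $N_1,\dots,N_n\ge 1$, and let $G$ be a finite simple graph with at least one edge on the vertex set $V=\{v_{i_1,\dots,i_n} : 1\le i_j\le N_j\}$ of size $N_1\cdots N_n$; its adjacency matrix $A(G)$ and degree matrix $D(G)$ are regarded as matrices on $\mathbb{C}^{N_1}\otimes\cdots\otimes\mathbb{C}^{N_n}$, the vertex $v_{i_1,\dots,i_n}$ corresponding to $e_{i_1}\otimes\cdots\otimes e_{i_n}$. For $1\le p\le n$ and a multi-index $I=(i_1,\dots,i_p)$, the layer $C_I$ of level $p$ is the set of vertices whose first $p$ indices are $i_1,\dots,i_p$, and $A_{I,J}$ denotes the block of $A(G)$ with rows in $C_I$ and columns in $C_J$, rows and columns being indexed by the remaining $n-p$ indices. Suppose that $G$ is partially symmetric, i.e. whenever $i_1\ne j_1$ and $(v_{i_1,i_2,\dots,i_n},v_{j_1,j_2,\dots,j_n})$ is an edge, $(v_{j_1,i_2,\dots,i_n},v_{i_1,j_2,\dots,j_n})$ is an edge as well, and that: (1) no edge joins two vertices of the same first-level layer $C_{i_1}$; (2) for every level $1\le p\le n-1$, any two nonzero blocks between distinct layers of level $p$ are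 equal: if $I\ne J$ and $K\ne L$ are multi-indices of length $p$, then $A_{I,J}=0$, or $A_{K,L}=0$, or $A_{I,J}=A_{K,L}$; (3) all vertices of the same first-level layer $C_{i_1}$ have the same degree. Let $Q(G)=D(G)+A(G)$. Then the density matrix $\rho_q(G)=Q(G)/\operatorname{tr}Q(G)$ is fully separable in $\mathbb{C}^{N_1}\otimes\cdots\otimes\mathbb{C}^{N_n}$, i.e. $\rho_q(G)=\sum_i q_i\,\rho_i^1\otimes\cdots\otimes\rho_i^n$ is a finite sum with $q_i\ge 0$, $\sum_i q_i=1$, and each $\rho_i^j$ a density matrix (positive semidefinite with trace $1$) on $\mathbb{C}^{N_j}$. -/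

import Mathlib

namespace GraphState

open scoped ComplexOrder

/-- Vertices `v_{i_1,…,i_n}` of a graph on `N_1 ⋯ N_n` vertices, labelled by multi-indices; these
also index the product basis of `H_1 ⊗ ⋯ ⊗ H_n` with `H_j = ℂ^{N_j}`. Indices start at `0`. -/
abbrev Vertex {n : ℕ} (N : Fin n → ℕ) : Type := ∀ j : Fin n, Fin (N j)

/-- Multi-indices `(i_1,…,i_p)`, which label the layers of level `p`. -/
abbrev Head {n : ℕ} (N : Fin n → ℕ) (p : ℕ) : Type := ∀ j : {j : Fin n // j.val < p}, Fin (N j)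

/-- The remaining indices `(i_{p+1},…,i_n)`, which label the vertices within a layer of level `p`. -/
abbrev Tail {n : ℕ} (N : Fin n → ℕ) (p : ℕ) : Type := ∀ j : {j : Fin n // ¬ j.val < p}, Fin (N j)

/-- The vertex with first indices `I` and remaining indices `x`. -/
def vertexOf {n : ℕ} {N : Fin n → ℕ} {p : ℕ} (I : Head N p) (x : Tail N p) : Vertex N :=
  fun j => if h : j.val < p then I ⟨j, h⟩ else x ⟨j, h⟩

/-- The layer `C_{i_1,…,i_p}` of level `p`. -/
def layer {n : ℕ} {N : Fin n → ℕ} {p : ℕ} (I : Head N p) : Set (Vertex N) :=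
  {v | ∀ j : {j : Fin n // j.val < p}, v j = I j}

/-- There is no edge between vertices of the layers `C_I` and `C_J`. -/
def NoEdgeBetween {n : ℕ} {N : Fin n → ℕ} (G : SimpleGraph (Vertex N)) {p : ℕ}
    (I J : Head N p) : Prop :=
  ∀ u ∈ layer I, ∀ v ∈ layer J, ¬ G.Adj u v

/-- The block `A_{I,J}` of the adjacency matrix, for layers `C_I`, `C_J` of level `p`. -/
def adjBlock {n : ℕ} {N : Fin n → ℕ} (G : SimpleGraph (Vertex N)) [DecidableRel G.Adj] {p : ℕ}
    (I J : Head N p) : Matrix (Tail N p) (Tail N p) ℂ :=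
  (G.adjMatrix ℂ).submatrix (vertexOf I) (vertexOf J)

/-- Partial symmetry: swapping the first indices of the two ends of an edge gives an edge. -/
def IsPartiallySymmetric {n : ℕ} [NeZero n] {N : Fin n → ℕ} (G : SimpleGraph (Vertex N)) : Prop :=
  ∀ u v : Vertex N, u 0 ≠ v 0 → G.Adj u v →
    G.Adj (Function.update u 0 (v 0)) (Function.update v 0 (u 0))

/-- At every level `p = 1, …, n - 1`, any two nonzero blocks of the adjacency matrix between
distinct layers are equal. -/
def EqualInterlayerBlocks {n : ℕ} {N : Fin n → ℕ} (G : SimpleGraph (Vertex N))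
    [DecidableRel G.Adj] : Prop :=
  ∀ p : ℕ, 1 ≤ p → p < n → ∀ I J K L : Head N p, I ≠ J → K ≠ L →
    NoEdgeBetween G I J ∨ NoEdgeBetween G K L ∨ adjBlock G I J = adjBlock G K L

/-- `Q(G) = D(G) + A(G)`. -/
def signlessLaplacian {V : Type*} [Fintype V] [DecidableEq V] (G : SimpleGraph V)
    [DecidableRel G.Adj] : Matrix V V ℂ :=
  G.degMatrix ℂ + G.adjMatrix ℂ

/-- `ρ_q(G) = Q(G) / tr Q(G)`; meaningful when `G` has an edge. -/
noncomputable def rhoQ {V : Type*} [Fintype V] [DecidableEq V] (G : SimpleGraph V)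
    [DecidableRel G.Adj] : Matrix V V ℂ :=
  (signlessLaplacian G).trace⁻¹ • signlessLaplacian G

/-- Density matrices: (Hermitian) positive semidefinite with unit trace. -/
def IsDensityMatrix {V : Type*} [Fintype V] (ρ : Matrix V V ℂ) : Prop :=
  ρ.PosSemidef ∧ ρ.trace = 1

/-- The tensor product `σ_1 ⊗ ⋯ ⊗ σ_n` in the product basis. -/
def tensorProd {n : ℕ} {N : Fin n → ℕ} (σ : ∀ j : Fin n, Matrix (Fin (N j)) (Fin (N j)) ℂ) :
    Matrix (Vertex N) (Vertex N) ℂ :=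
  Matrix.of fun u v => ∏ j, σ j (u j) (v j)

/-- Full separability: a finite convex combination of tensor products of density matrices. -/
def IsFullySeparable {n : ℕ} {N : Fin n → ℕ} (ρ : Matrix (Vertex N) (Vertex N) ℂ) : Prop :=
  ∃ (m : ℕ) (q : Fin m → ℝ) (σ : Fin m → ∀ j : Fin n, Matrix (Fin (N j)) (Fin (N j)) ℂ),
    (∀ i, 0 ≤ q i) ∧ ∑ i, q i = 1 ∧ (∀ i j, IsDensityMatrix (σ i j)) ∧
      ρ = ∑ i, (q i : ℂ) • tensorProd (σ i)

end GraphState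

/-!
The block condition lets the first `p` indices of one edge be joined with the remaining indices of
another, so adjacency can be checked index by index: `A(G)` is a tensor product `⨂ A_j` of symmetric
zero-one matrices. Row sums are multiplicative, hence `D(G) = ⨂ D_j` with `D_j` the diagonal of row
sums of `A_j`. Expanding over signs `s_j = ±1`,
`2 ^ n • (⨂ D_j + ⨂ A_j) = ∑ s, (1 + ∏ j, s_j) • ⨂ (D_j + s_j A_j)`,
where the coefficients are nonnegative and each `D_j ± A_j` is diagonally dominant, hence positive
semidefinite.
-/

namespace GraphState

open scoped ComplexOrder Matrix NNReal

section Separability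

variable {n : ℕ} {N : Fin n → ℕ}

theorem trace_tensorProd (σ : ∀ j, Matrix (Fin (N j)) (Fin (N j)) ℂ) :
    (tensorProd σ).trace = ∏ j, (σ j).trace :=
  (Fintype.prod_sum fun j x => σ j x x).symm

theorem tensorProd_smul {R : Type*} [CommMonoid R] [MulAction R ℂ] [IsScalarTower R ℂ ℂ]
    [SMulCommClass R ℂ ℂ] (c : Fin n → R) (σ : ∀ j, Matrix (Fin (N j)) (Fin (N j)) ℂ) :
    tensorProd (fun j => c j • σ j) = (∏ j, c j) • tensorProd σ := by
  ext u v
  exact Finset.prod_smul Finset.univ c fun j => σ j (u j) (v j)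

theorem tensorProd_sum {κ : Fin n → Type*} [∀ j, Fintype (κ j)]
    (σ : ∀ j, κ j → Matrix (Fin (N j)) (Fin (N j)) ℂ) :
    tensorProd (fun j => ∑ k, σ j k) = ∑ s : ∀ j, κ j, tensorProd fun j => σ j (s j) := by
  ext u v
  simp only [tensorProd, Matrix.of_apply, Matrix.sum_apply, Fintype.prod_sum]

variable (N) in
/-- The cone generated by the tensor products of positive semidefinite matrices. Its elements of
trace one are the fully separable density matrices. -/
noncomputable def separableCone : Submodule ℝ≥0 (Matrix (Vertex N) (Vertex N) ℂ) :=
  Submodule.span ℝ≥0 {M | ∃ τ : ∀ j, Matrix (Fin (N j)) (Fin (N j)) ℂ,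
    (∀ j, (τ j).PosSemidef) ∧ tensorProd τ = M}

theorem tensorProd_mem_separableCone {τ : ∀ j, Matrix (Fin (N j)) (Fin (N j)) ℂ}
    (hτ : ∀ j, (τ j).PosSemidef) : tensorProd τ ∈ separableCone N :=
  Submodule.subset_span ⟨τ, hτ, rfl⟩

theorem exists_isDensityMatrix (V : Type*) [Fintype V] [Nonempty V] :
    ∃ σ : Matrix V V ℂ, IsDensityMatrix σ := by
  classical
  obtain ⟨a⟩ := ‹Nonempty V›
  refine ⟨Matrix.diagonal (Pi.single a 1), .diagonal (Pi.single_nonneg.2 zero_le_one), ?_⟩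
  rw [Matrix.trace_diagonal, Finset.sum_pi_single']
  simp

theorem exists_eq_smul_isDensityMatrix {V : Type*} [Fintype V] [Nonempty V]
    {τ : Matrix V V ℂ} (hτ : τ.PosSemidef) :
    ∃ (t : ℝ≥0) (σ : Matrix V V ℂ), IsDensityMatrix σ ∧ τ = t • σ := by
  obtain ⟨t, ht⟩ : ∃ t : ℝ≥0, (t : ℂ) = τ.trace := by
    obtain ⟨r, hr, hrτ⟩ := RCLike.nonneg_iff_exists_ofReal.1 hτ.trace_nonneg
    exact ⟨⟨r, hr⟩, hrτ⟩
  obtain rfl | ht0 := eq_or_ne t 0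
  · obtain ⟨σ, hσ⟩ := exists_isDensityMatrix V
    exact ⟨0, σ, hσ, by rw [zero_smul, ← hτ.trace_eq_zero_iff, ← ht]; rfl⟩
  · refine ⟨t, t⁻¹ • τ, ⟨hτ.smul zero_le, ?_⟩, (smul_inv_smul₀ ht0 τ).symm⟩
    rw [Matrix.trace_smul, ← ht]
    simp [NNReal.smul_def, ht0]

theorem exists_eq_sum_smul_tensorProd [∀ j, Nonempty (Fin (N j))]
    {M : Matrix (Vertex N) (Vertex N) ℂ} (hM : M ∈ separableCone N) :
    ∃ (m : ℕ) (w : Fin m → ℝ≥0) (σ : Fin m → ∀ j, Matrix (Fin (N j)) (Fin (N j)) ℂ),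
      (∀ i j, IsDensityMatrix (σ i j)) ∧ M = ∑ i, w i • tensorProd (σ i) := by
  obtain ⟨m, c, g, rfl⟩ := Submodule.mem_span_set'.1 hM
  choose τ hτ hτg using fun i => (g i).2
  choose t σ hσ hτσ using fun i j => exists_eq_smul_isDensityMatrix (hτ i j)
  refine ⟨m, fun i => c i * ∏ j, t i j, σ, hσ, Finset.sum_congr rfl fun i _ => ?_⟩
  rw [← hτg, funext (hτσ i), tensorProd_smul, smul_smul]

theorem isFullySeparable_trace_inv_smul {M : Matrix (Vertex N) (Vertex N) ℂ}
    (hM : M ∈ separableCone N) (htr : M.trace ≠ 0) : IsFullySeparable (M.trace⁻¹ • M) := by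
  obtain ⟨u, -, -⟩ := Finset.exists_ne_zero_of_sum_ne_zero htr
  have (j : Fin n) : Nonempty (Fin (N j)) := ⟨u j⟩
  obtain ⟨m, w, σ, hσ, rfl⟩ := exists_eq_sum_smul_tensorProd hM
  have trace_eq : (∑ i, w i • tensorProd (σ i)).trace = ((∑ i, w i : ℝ≥0) : ℂ) := by
    simp [Matrix.trace_sum, trace_tensorProd, (hσ _ _).2, NNReal.smul_def]
  rw [trace_eq] at htr ⊢
  have hw : ∑ i, w i ≠ 0 := by exact_mod_cast htr
  refine ⟨m, fun i => ((∑ i, w i)⁻¹ * w i : ℝ≥0), σ, fun i => NNReal.coe_nonneg _, ?_, hσ, ?_⟩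
  · rw [← NNReal.coe_sum, ← Finset.mul_sum, inv_mul_cancel₀ hw, NNReal.coe_one]
  · rw [Finset.smul_sum]
    refine Finset.sum_congr rfl fun i _ => ?_
    rw [NNReal.smul_def, ← Complex.coe_smul, smul_smul]
    push_cast
    rfl

end Separability

section SignExpansion

variable {n : ℕ} {N : Fin n → ℕ} (D B : ∀ j : Fin n, Matrix (Fin (N j)) (Fin (N j)) ℂ)

theorem sum_tensorProd_add_units_smul :
    ∑ s : Fin n → ℤˣ, tensorProd (fun j => D j + s j • B j) = (2 ^ n : ℝ≥0) • tensorProd D := by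
  have sum_signs (j : Fin n) : ∑ s : ℤˣ, (D j + s • B j) = (2 : ℝ≥0) • D j := by
    rw [UnitsInt.univ, Finset.sum_pair (by decide), one_smul, Units.neg_smul, one_smul,
      two_smul]
    abel
  rw [← tensorProd_sum fun j (s : ℤˣ) => D j + s • B j, funext sum_signs, tensorProd_smul]
  simp

theorem sum_prod_smul_tensorProd_add_units_smul :
    ∑ s : Fin n → ℤˣ, (∏ j, s j) • tensorProd (fun j => D j + s j • B j) =
      (2 ^ n : ℝ≥0) • tensorProd B := by
  rw [← sum_tensorProd_add_units_smul B D]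
  refine Finset.sum_congr rfl fun s _ => ?_
  rw [← tensorProd_smul]
  congr! 2 with j
  rw [smul_add, smul_smul, Int.units_mul_self, one_smul, add_comm]

variable {D B} in
theorem tensorProd_add_tensorProd_mem_separableCone
    (h : ∀ j (s : ℤˣ), (D j + s • B j).PosSemidef) :
    tensorProd D + tensorProd B ∈ separableCone N := by
  have hpow : (2 ^ n : ℝ≥0) ≠ 0 := by positivity
  rw [← Submodule.smul_mem_iff _ hpow, smul_add, ← sum_tensorProd_add_units_smul D B,
    ← sum_prod_smul_tensorProd_add_units_smul D B, ← Finset.sum_add_distrib]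
  refine Submodule.sum_mem _ fun s _ => ?_
  have hs := tensorProd_mem_separableCone fun j => h j (s j)
  obtain hsign | hsign := Int.units_eq_one_or (∏ j, s j)
  · rw [hsign, one_smul]
    exact add_mem hs hs
  · rw [hsign, Units.neg_smul, one_smul, add_neg_cancel]
    exact zero_mem _

end SignExpansion

section RowSums

theorem posSemidef_of_diagonally_dominant {V 𝕜 : Type*} [Fintype V] [DecidableEq V] [RCLike 𝕜]
    {A : Matrix V V 𝕜} (hA : A.IsHermitian)
    (hdom : ∀ k, ∑ j ∈ Finset.univ.erase k, ‖A k j‖ ≤ RCLike.re (A k k)) : A.PosSemidef := by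
  rw [hA.posSemidef_iff_eigenvalues_nonneg]
  intro i
  have heig : Module.End.HasEigenvalue (Matrix.toLin' A) (hA.eigenvalues i : 𝕜) := by
    rw [Module.End.hasEigenvalue_iff_mem_spectrum, Matrix.spectrum_toLin',
      hA.spectrum_eq_image_range]
    exact ⟨_, ⟨i, rfl⟩, rfl⟩
  obtain ⟨k, hk⟩ := eigenvalue_mem_ball heig
  have hre : RCLike.re (A k k) - hA.eigenvalues i ≤ RCLike.re (A k k) := by
    calc RCLike.re (A k k) - hA.eigenvalues i = RCLike.re (A k k - (hA.eigenvalues i : 𝕜)) := by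
          simp
      _ ≤ ‖A k k - (hA.eigenvalues i : 𝕜)‖ := RCLike.re_le_norm _
      _ ≤ ∑ j ∈ Finset.univ.erase k, ‖A k j‖ := by
          rwa [mem_closedBall_iff_norm'] at hk
      _ ≤ RCLike.re (A k k) := hdom k
  simpa using hre

theorem posSemidef_diagonal_sum_norm_add {V 𝕜 : Type*} [Fintype V] [DecidableEq V] [RCLike 𝕜]
    {A : Matrix V V 𝕜} (hA : A.IsHermitian) :
    (Matrix.diagonal (fun x => ((∑ y, ‖A x y‖ : ℝ) : 𝕜)) + A).PosSemidef := by
  have hdiag : (Matrix.diagonal fun x => ((∑ y, ‖A x y‖ : ℝ) : 𝕜)).IsHermitian :=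
    Matrix.isHermitian_diagonal_iff.2 fun _ => RCLike.conj_ofReal _
  refine posSemidef_of_diagonally_dominant (hdiag.add hA) fun k => ?_
  calc ∑ j ∈ Finset.univ.erase k, ‖(Matrix.diagonal (fun x => ((∑ y, ‖A x y‖ : ℝ) : 𝕜)) + A) k j‖
      = ∑ j ∈ Finset.univ.erase k, ‖A k j‖ := by
        refine Finset.sum_congr rfl fun j hj => ?_
        rw [Matrix.add_apply, Matrix.diagonal_apply_ne' _ (Finset.ne_of_mem_erase hj), zero_add]
    _ = ∑ j, ‖A k j‖ - ‖A k k‖ := Finset.sum_erase_eq_sub (Finset.mem_univ k)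
    _ ≤ ∑ j, ‖A k j‖ + RCLike.re (A k k) := by
        linarith [neg_le_of_abs_le (RCLike.abs_re_le_norm (A k k))]
    _ = RCLike.re ((Matrix.diagonal (fun x => ((∑ y, ‖A x y‖ : ℝ) : 𝕜)) + A) k k) := by
        rw [Matrix.add_apply, Matrix.diagonal_apply_eq, map_add, RCLike.ofReal_re]

theorem posSemidef_diagonal_rowSum_add_units_smul {V 𝕜 : Type*} [Fintype V] [DecidableEq V]
    [RCLike 𝕜] {A : Matrix V V 𝕜} (hA : A.IsHermitian) (hpos : ∀ x y, 0 ≤ A x y) (s : ℤˣ) :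
    (Matrix.diagonal (A *ᵥ 1) + s • A).PosSemidef := by
  have hsA : (s • A).IsHermitian := by
    obtain rfl | rfl := Int.units_eq_one_or s
    · rwa [one_smul]
    · rw [Units.neg_smul, one_smul]
      exact hA.neg
  have norm_eq (x y : V) : (‖(s • A) x y‖ : 𝕜) = A x y := by
    have norm_smul_eq : ‖(s • A) x y‖ = ‖A x y‖ := by
      obtain rfl | rfl := Int.units_eq_one_or s <;> simp
    rw [norm_smul_eq, RCLike.norm_of_nonneg' (hpos x y)]
  have row_sum : A *ᵥ 1 = fun x => ((∑ y, ‖(s • A) x y‖ : ℝ) : 𝕜) := by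
    funext x
    rw [RCLike.ofReal_sum, Finset.sum_congr rfl fun y _ => norm_eq x y]
    simp [Matrix.mulVec, dotProduct]
  rw [row_sum]
  exact posSemidef_diagonal_sum_norm_add hsA

theorem diagonal_rowSum_tensorProd {n : ℕ} {N : Fin n → ℕ}
    (B : ∀ j, Matrix (Fin (N j)) (Fin (N j)) ℂ) :
    Matrix.diagonal (tensorProd B *ᵥ 1) = tensorProd fun j => Matrix.diagonal (B j *ᵥ 1) := by
  have row_sum (u : Vertex N) : (tensorProd B *ᵥ 1) u = ∏ j, (B j *ᵥ 1) (u j) := by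
    simp [Matrix.mulVec, dotProduct, tensorProd, Fintype.prod_sum]
  ext u v
  rw [Matrix.diagonal_apply, row_sum]
  simp [Matrix.diagonal_apply, tensorProd, Finset.prod_ite_zero, funext_iff]

theorem diagonal_rowSum_add_tensorProd_mem_separableCone {n : ℕ} {N : Fin n → ℕ}
    {B : ∀ j, Matrix (Fin (N j)) (Fin (N j)) ℂ} (hB : ∀ j, (B j).IsHermitian)
    (hpos : ∀ j x y, 0 ≤ B j x y) :
    Matrix.diagonal (tensorProd B *ᵥ 1) + tensorProd B ∈ separableCone N := by
  rw [diagonal_rowSum_tensorProd]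
  exact tensorProd_add_tensorProd_mem_separableCone fun j s =>
    posSemidef_diagonal_rowSum_add_units_smul (hB j) (hpos j) s

end RowSums

section Coordinates

theorem signlessLaplacian_eq_diagonal_rowSum_add {V : Type*} [Fintype V] [DecidableEq V]
    (G : SimpleGraph V) [DecidableRel G.Adj] :
    signlessLaplacian G = Matrix.diagonal (G.adjMatrix ℂ *ᵥ 1) + G.adjMatrix ℂ := by
  have degree_eq : (G.adjMatrix ℂ *ᵥ 1) = fun v => (G.degree v : ℂ) := by
    funext v
    exact (G.adjMatrix_mulVec_const_apply).trans (mul_one _)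
  rw [signlessLaplacian, SimpleGraph.degMatrix, degree_eq]

theorem trace_signlessLaplacian {V : Type*} [Fintype V] [DecidableEq V] (G : SimpleGraph V)
    [DecidableRel G.Adj] : (signlessLaplacian G).trace = 2 * G.edgeFinset.card := by
  rw [signlessLaplacian, Matrix.trace_add, SimpleGraph.trace_adjMatrix, add_zero,
    SimpleGraph.degMatrix, Matrix.trace_diagonal]
  exact_mod_cast G.sum_degrees_eq_twice_card_edges

variable {n : ℕ} {N : Fin n → ℕ}

theorem signlessLaplacian_mem_separableCone {G : SimpleGraph (Vertex N)} [DecidableRel G.Adj]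
    {B : ∀ j, Matrix (Fin (N j)) (Fin (N j)) ℂ} (hB : ∀ j, (B j).IsHermitian)
    (hpos : ∀ j x y, 0 ≤ B j x y) (hG : G.adjMatrix ℂ = tensorProd B) :
    signlessLaplacian G ∈ separableCone N := by
  rw [signlessLaplacian_eq_diagonal_rowSum_add, hG]
  exact diagonal_rowSum_add_tensorProd_mem_separableCone hB hpos

/-- The relation between the `j`-th indices of adjacent vertices. It may relate an index to itself,
so it need not be a graph. -/
def coordRel (G : SimpleGraph (Vertex N)) (j : Fin n) (x y : Fin (N j)) : Prop :=
  ∃ u v, G.Adj u v ∧ u j = x ∧ v j = y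

theorem coordRel_comm (G : SimpleGraph (Vertex N)) (j : Fin n) (x y : Fin (N j)) :
    coordRel G j x y ↔ coordRel G j y x := by
  have swap (x y : Fin (N j)) : coordRel G j x y → coordRel G j y x :=
    fun ⟨u, v, h, hu, hv⟩ => ⟨v, u, h.symm, hv, hu⟩
  exact ⟨swap x y, swap y x⟩

open Classical in
/-- The zero-one matrix of `coordRel G j`, the tensor factor of the adjacency matrix at `j` when
adjacency is checked index by index. -/
noncomputable def coordMatrix (G : SimpleGraph (Vertex N)) (j : Fin n) :
    Matrix (Fin (N j)) (Fin (N j)) ℂ :=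
  Matrix.of fun x y => if coordRel G j x y then 1 else 0

theorem isHermitian_coordMatrix (G : SimpleGraph (Vertex N)) (j : Fin n) :
    (coordMatrix G j).IsHermitian := by
  classical
  ext x y
  simp only [coordMatrix, Matrix.conjTranspose_apply, Matrix.of_apply, apply_ite star, star_one,
    star_zero]
  exact if_congr (coordRel_comm G j y x) rfl rfl

theorem coordMatrix_nonneg (G : SimpleGraph (Vertex N)) (j : Fin n) (x y : Fin (N j)) :
    0 ≤ coordMatrix G j x y := by
  simp only [coordMatrix, Matrix.of_apply]
  split_ifs <;> simp

theorem adjMatrix_eq_tensorProd_coordMatrix {G : SimpleGraph (Vertex N)} [DecidableRel G.Adj]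
    (h : ∀ u v, G.Adj u v ↔ ∀ j, coordRel G j (u j) (v j)) :
    G.adjMatrix ℂ = tensorProd (coordMatrix G) := by
  classical
  ext u v
  simp [tensorProd, coordMatrix, SimpleGraph.adjMatrix_apply, h, Finset.prod_ite_zero]

end Coordinates

section Blocks

variable {n : ℕ} {N : Fin n → ℕ}

/-- The first `p` indices `(i_1,…,i_p)` of a vertex, i.e. the label of its layer of level `p`. -/
def head (p : ℕ) (u : Vertex N) : Head N p := fun j => u j

/-- The indices `(i_{p+1},…,i_n)` of a vertex, which locate it inside its layer of level `p`. -/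
def tail (p : ℕ) (u : Vertex N) : Tail N p := fun j => u j

theorem vertexOf_head_tail (p : ℕ) (u : Vertex N) : vertexOf (head p u) (tail p u) = u := by
  funext j
  simp [vertexOf, head, tail]

theorem vertexOf_head_tail_apply_of_lt {p : ℕ} {j : Fin n} (hj : j.val < p) (u v : Vertex N) :
    vertexOf (head p u) (tail p v) j = u j :=
  dif_pos hj

theorem vertexOf_head_tail_apply_of_le {p : ℕ} {j : Fin n} (hj : p ≤ j.val) (u v : Vertex N) :
    vertexOf (head p u) (tail p v) j = v j :=
  dif_neg hj.not_gt

variable {G : SimpleGraph (Vertex N)}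

theorem adj_vertexOf_iff_of_adjBlock_eq [DecidableRel G.Adj] {p : ℕ} {I J K L : Head N p}
    (h : adjBlock G I J = adjBlock G K L) (x y : Tail N p) :
    G.Adj (vertexOf I x) (vertexOf J y) ↔ G.Adj (vertexOf K x) (vertexOf L y) := by
  have entry_eq := congr_fun₂ h x y
  simp only [adjBlock, Matrix.submatrix_apply, SimpleGraph.adjMatrix_apply] at entry_eq
  split_ifs at entry_eq <;> simp_all

variable [NeZero n] (hlayer : ∀ u v : Vertex N, u 0 = v 0 → ¬ G.Adj u v)

include hlayer

theorem head_ne_head_of_adj {p : ℕ} (hp : 1 ≤ p) {u v : Vertex N} (h : G.Adj u v) :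
    head p u ≠ head p v :=
  fun heq => hlayer u v (congr_fun heq ⟨0, hp⟩) h

variable [DecidableRel G.Adj] (hblock : EqualInterlayerBlocks G)

include hblock

theorem adjBlock_head_eq_of_adj {p : ℕ} (hp : 1 ≤ p) (hpn : p < n) {u v u' v' : Vertex N}
    (h : G.Adj u v) (h' : G.Adj u' v') :
    adjBlock G (head p u) (head p v) = adjBlock G (head p u') (head p v') := by
  obtain hno | hno | heq := hblock p hp hpn _ _ _ _ (head_ne_head_of_adj hlayer hp h)
    (head_ne_head_of_adj hlayer hp h')
  · exact absurd h (hno u (fun _ => rfl) v fun _ => rfl)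
  · exact absurd h' (hno u' (fun _ => rfl) v' fun _ => rfl)
  · exact heq

theorem adj_vertexOf_head_tail {p : ℕ} (hp : 1 ≤ p) (hpn : p < n) {u v u' v' : Vertex N}
    (h : G.Adj u v) (h' : G.Adj u' v') :
    G.Adj (vertexOf (head p u) (tail p u')) (vertexOf (head p v) (tail p v')) := by
  rwa [adj_vertexOf_iff_of_adjBlock_eq (adjBlock_head_eq_of_adj hlayer hblock hp hpn h h'),
    vertexOf_head_tail, vertexOf_head_tail]

theorem exists_adj_forall_lt_eq {u v : Vertex N} (h : ∀ j, coordRel G j (u j) (v j)) {p : ℕ}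
    (hp : 1 ≤ p) (hpn : p ≤ n) :
    ∃ a b, G.Adj a b ∧ ∀ j : Fin n, j.val < p → a j = u j ∧ b j = v j := by
  induction p, hp using Nat.le_induction with
  | base =>
    obtain ⟨a, b, hab, ha, hb⟩ := h 0
    refine ⟨a, b, hab, fun j hj => ?_⟩
    obtain rfl : j = 0 := Fin.ext (Nat.lt_one_iff.1 hj)
    exact ⟨ha, hb⟩
  | succ p hp ih =>
    obtain ⟨a, b, hab, hagree⟩ := ih (Nat.le_of_succ_le hpn)
    obtain ⟨a', b', hab', ha', hb'⟩ := h ⟨p, hpn⟩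
    refine ⟨_, _, adj_vertexOf_head_tail hlayer hblock hp hpn hab hab', fun j hj => ?_⟩
    obtain hjp | hjp := Nat.lt_succ_iff_lt_or_eq.1 hj
    · simpa only [vertexOf_head_tail_apply_of_lt hjp] using hagree j hjp
    · obtain rfl : j = ⟨p, hpn⟩ := Fin.ext hjp
      exact ⟨(vertexOf_head_tail_apply_of_le le_rfl _ _).trans ha',
        (vertexOf_head_tail_apply_of_le le_rfl _ _).trans hb'⟩

theorem adj_iff_forall_coordRel (u v : Vertex N) :
    G.Adj u v ↔ ∀ j, coordRel G j (u j) (v j) := by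
  refine ⟨fun h j => ⟨u, v, h, rfl, rfl⟩, fun h => ?_⟩
  obtain ⟨a, b, hab, hagree⟩ := exists_adj_forall_lt_eq hlayer hblock h NeZero.one_le le_rfl
  obtain rfl : a = u := funext fun j => (hagree j j.isLt).1
  obtain rfl : b = v := funext fun j => (hagree j j.isLt).2
  exact hab

end Blocks

end GraphState

theorem theorem4_general {n : ℕ} [NeZero n] (N : Fin n → ℕ)
    (G : SimpleGraph (GraphState.Vertex N)) [DecidableRel G.Adj]
    (hne : ∃ u v : GraphState.Vertex N, G.Adj u v)
    (hlayer : ∀ u v : GraphState.Vertex N, u 0 = v 0 → ¬ G.Adj u v)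
    (hblock : GraphState.EqualInterlayerBlocks G) :
    GraphState.IsFullySeparable (GraphState.rhoQ G) := by
  have hcone := GraphState.signlessLaplacian_mem_separableCone
    (GraphState.isHermitian_coordMatrix G) (GraphState.coordMatrix_nonneg G)
    (GraphState.adjMatrix_eq_tensorProd_coordMatrix
      (GraphState.adj_iff_forall_coordRel hlayer hblock))
  have hcard : G.edgeFinset.card ≠ 0 := by
    rwa [Finset.card_ne_zero, SimpleGraph.edgeFinset_nonempty, SimpleGraph.ne_bot_iff_exists_adj]
  have htrace : (GraphState.signlessLaplacian G).trace ≠ 0 := by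
    rw [GraphState.trace_signlessLaplacian]
    exact_mod_cast mul_ne_zero two_ne_zero hcard
  exact GraphState.isFullySeparable_trace_inv_smul hcone htrace

theorem theorem4 {n : ℕ} [NeZero n] (N : Fin n → ℕ)
    (G : SimpleGraph (GraphState.Vertex N)) [DecidableRel G.Adj]
    (hne : ∃ u v : GraphState.Vertex N, G.Adj u v)
    (hsymm : GraphState.IsPartiallySymmetric G)
    (hlayer : ∀ u v : GraphState.Vertex N, u 0 = v 0 → ¬ G.Adj u v)
    (hblock : GraphState.EqualInterlayerBlocks G)
    (hdeg : ∀ u v : GraphState.Vertex N, u 0 = v 0 → G.degree u = G.degree v) :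
    GraphState.IsFullySeparable (GraphState.rhoQ G) :=
  theorem4_general N G hne hlayer hblock
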